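/- Let $\mathbf V$ be a variety of (nonempty) algebras with finitary operations, and let $\vec 0=(0_1,\dots,0_n)$, $\vec 1=(1_1,\dots,1_n)$ be tuples of $0$-ary terms such that $\mathbf V\models \vec 0\approx\vec 1\rightarrow x\approx y$. Congruences $\theta,\delta$ of $A$ are complementary factor congruences if $\theta\cap\delta$ is equality and $\theta\circ\delta=A\times A$; a factor congruence is a member of such a pair, and $FC(A)$ is the set of them. Assume that $\mathbf V$ has Boolean factor congruences (BFC): for every $A\in\mathbf V$, $FC(A)$ is a Boolean sublattice of $\mathrm{Con}(A)$. For $\vec a\in A^n$, $\vec b\in B^n$ put $[\vec a,\vec b]=((a_1,b_1),\dots,(a_n,b_n))\in(A\times B)^n$. A tuple $\vec e\in A^n$ is a central element of $A$ if some isomorphism $\tau:A\to A_1\times A_2$ satisfies $\tau(\vec e)=[\vec 0,\vec 1]$; let $Z(A)$ be the set of central elements. By BFC, for $\vec e\in Z(A)$ there is a unique pair $(\theta^A_{\vec 0,\vec e},\theta^A_{\vec 1,\vec e})$ of complementary factor congruences with $(e_i,0_i)\in\theta^A_{\vec 0,\vec e}$ and $(e_i,1_i)\in\theta^A_{\vec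 1,\vec e}$ for all $i$. Let $\theta^A(\vec a,\vec b)$ be the least congruence of $A$ containing all pairs $(a_i,b_i)$. Finally, $\mathbf V$ has RexDFC (right existentially definable factor congruences) if there is an existential first-order formula $\lambda(\vec z,x,y)$ such that for all $A,B\in\mathbf V$, $a,b\in A$ and $c,d\in B$: $A\times B\models\lambda([\vec 0,\vec 1],(a,c),(b,d))$ if and only if $c=d$. Then: 1. $\mathbf V$ has RexDFC if and only if, for every $A\in\mathbf V$ and every $\vec e\in Z(A)$, $\theta^A_{\vec 1,\vec e}=\theta^A(\vec 1,\vec e)$. 2. If $\mathbf V$ has RexDFC then, for every $A\in\mathbf V$, the map $\vec e\mapsto\theta^A(\vec 1,\vec e)$ is a bijection from $Z(A)$ onto $FC(A)$. -/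

import Mathlib

universe u v w

namespace CentralElements

open FirstOrder FirstOrder.Language FirstOrder.Language.Structure

/-- The direct product of two structures, with operations (and relations) computed coordinatewise. -/
instance prodStructure (L : FirstOrder.Language.{u, v}) (A : Type*) (B : Type*) [L.Structure A]
    [L.Structure B] : L.Structure (A × B) where
  funMap f x := (funMap f fun i => (x i).1, funMap f fun i => (x i).2)
  RelMap r x := (RelMap r fun i => (x i).1) ∧ RelMap r fun i => (x i).2

/-- A congruence of the algebra `A`: an equivalence relation compatible with all basic operations. -/
structure Congruence (L : FirstOrder.Language.{u, v}) (A : Type w) [L.Structure A] extends Setoid A where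
  compat : ∀ {k : ℕ} (f : L.Functions k) (x y : Fin k → A),
    (∀ i, toSetoid.r (x i) (y i)) → toSetoid.r (funMap f x) (funMap f y)

namespace Congruence

variable {L : FirstOrder.Language.{u, v}} {A : Type w} [L.Structure A]

/-- The underlying relation of a congruence: `θ.Rel a b` means `(a, b) ∈ θ`. -/
def Rel (θ : Congruence L A) (a b : A) : Prop := θ.toSetoid.r a b

theorem rel_refl (θ : Congruence L A) (a : A) : θ.Rel a a := θ.toSetoid.iseqv.refl a

theorem rel_symm (θ : Congruence L A) {a b : A} (h : θ.Rel a b) : θ.Rel b a :=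
  θ.toSetoid.iseqv.symm h

theorem rel_trans (θ : Congruence L A) {a b c : A} (h : θ.Rel a b) (h' : θ.Rel b c) :
    θ.Rel a c := θ.toSetoid.iseqv.trans h h'

theorem ext_rel {θ δ : Congruence L A} (h : ∀ a b, θ.Rel a b ↔ δ.Rel a b) : θ = δ := by
  obtain ⟨s, hs⟩ := θ
  obtain ⟨t, ht⟩ := δ
  have : s = t := Setoid.ext h
  subst this
  rfl

/-- Congruences are ordered by inclusion. -/
instance : PartialOrder (Congruence L A) where
  le θ δ := ∀ a b, θ.Rel a b → δ.Rel a b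
  le_refl _ _ _ h := h
  le_trans _ _ _ h h' a b hab := h' a b (h a b hab)
  le_antisymm _ _ h h' := ext_rel fun a b => ⟨h a b, h' a b⟩

/-- The infimum of a set of congruences is their intersection. -/
instance : InfSet (Congruence L A) where
  sInf S :=
    { r := fun a b => ∀ θ ∈ S, θ.Rel a b
      iseqv :=
        ⟨fun a θ _ => θ.rel_refl a, fun h θ hθ => θ.rel_symm (h θ hθ),
          fun h h' θ hθ => θ.rel_trans (h θ hθ) (h' θ hθ)⟩
      compat := fun f x y h θ hθ => θ.compat f x y fun i => h i θ hθ }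

/-- The congruence lattice `Con(A)`: meet is intersection, bottom is equality, top is the
universal relation, and joins are computed in the lattice of congruences. -/
instance : CompleteLattice (Congruence L A) where
  __ := completeLatticeOfInf (Congruence L A) fun _ =>
    ⟨fun _ hθ _ _ h => h _ hθ, fun _ hγ a b hab θ hθ => hγ hθ a b hab⟩
  inf θ δ :=
    { r := fun a b => θ.Rel a b ∧ δ.Rel a b
      iseqv :=
        ⟨fun a => ⟨θ.rel_refl a, δ.rel_refl a⟩, fun h => ⟨θ.rel_symm h.1, δ.rel_symm h.2⟩,
          fun h h' => ⟨θ.rel_trans h.1 h'.1, δ.rel_trans h.2 h'.2⟩⟩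
      compat := fun f x y h =>
        ⟨θ.compat f x y fun i => (h i).1, δ.compat f x y fun i => (h i).2⟩ }
  inf_le_left _ _ _ _ h := h.1
  inf_le_right _ _ _ _ h := h.2
  le_inf _ _ _ h h' a b hab := ⟨h a b hab, h' a b hab⟩
  bot :=
    { r := fun a b => a = b
      iseqv := eq_equivalence
      compat := fun f _ _ h => congrArg (funMap f) (funext h) }
  bot_le θ a _ h := h ▸ θ.rel_refl a
  top :=
    { r := fun _ _ => True
      iseqv := ⟨fun _ => trivial, fun _ => trivial, fun _ _ => trivial⟩
      compat := fun _ _ _ _ => trivial }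
  le_top _ _ _ _ := trivial

/-- `θ(a⃗, b⃗)`: the least congruence containing all the pairs `(a i, b i)`. -/
def principal {n : ℕ} (a b : Fin n → A) : Congruence L A :=
  sInf {θ | ∀ i, θ.Rel (a i) (b i)}

/-- `θ` and `δ` are complementary factor congruences: `θ ∩ δ = Δ` and `θ ∘ δ = ∇`. -/
def Complementary (θ δ : Congruence L A) : Prop :=
  θ ⊓ δ = ⊥ ∧ ∀ a b, ∃ c, θ.Rel a c ∧ δ.Rel c b

/-- `θ` is a factor congruence, i.e. `θ ∈ FC(A)`. -/
def IsFactor (θ : Congruence L A) : Prop := ∃ δ, Complementary θ δ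

end Congruence

/-- `S` is a Boolean sublattice of the bounded lattice `α`: a sublattice containing `⊥` and `⊤`
which is distributive and complemented. -/
structure IsBooleanSublattice {α : Type*} [Lattice α] [BoundedOrder α] (S : Set α) : Prop where
  bot_mem : ⊥ ∈ S
  top_mem : ⊤ ∈ S
  sup_mem : ∀ x ∈ S, ∀ y ∈ S, x ⊔ y ∈ S
  inf_mem : ∀ x ∈ S, ∀ y ∈ S, x ⊓ y ∈ S
  inf_sup_distrib : ∀ x ∈ S, ∀ y ∈ S, ∀ z ∈ S, x ⊓ (y ⊔ z) = (x ⊓ y) ⊔ (x ⊓ z)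
  exists_compl : ∀ x ∈ S, ∃ y ∈ S, IsCompl x y

/-- A variety of `L`-algebras, presented by a set of identities `p.1 ≈ p.2` in countably many
variables. -/
structure Variety (L : FirstOrder.Language.{u, v}) where
  identities : Set (L.Term ℕ × L.Term ℕ)

/-- The value in `A` of the `0`-ary term `t`. -/
def const {L : FirstOrder.Language.{u, v}} (A : Type w) [L.Structure A] (t : L.Term Empty) : A :=
  t.realize (fun x : Empty => x.elim)

namespace Variety

variable {L : FirstOrder.Language.{u, v}} (V : Variety L)

/-- `A ∈ V`: the (nonempty) algebra `A` satisfies all the identities of `V`. -/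
structure Mem (A : Type w) [L.Structure A] : Prop where
  nonempty : Nonempty A
  realize_eq : ∀ p ∈ V.identities, ∀ x : ℕ → A, p.1.realize x = p.2.realize x

/-- `V` is a variety with `0⃗` and `1⃗`, i.e. `V ⊨ 0⃗ ≈ 1⃗ → x ≈ y`, for the given `0`-ary terms. -/
def HasZeroOne {n : ℕ} (zero one : Fin n → L.Term Empty) : Prop :=
  ∀ (A : Type w) [L.Structure A], V.Mem A →
    (∀ i, const A (zero i) = const A (one i)) → ∀ x y : A, x = y

/-- `V` has Boolean factor congruences: in every algebra of `V` the factor congruences form a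
Boolean sublattice of the congruence lattice. -/
def HasBFC : Prop :=
  ∀ (A : Type w) [L.Structure A], V.Mem A →
    IsBooleanSublattice {θ : Congruence L A | θ.IsFactor}

/-- `V` has right existentially definable factor congruences: there is an existential formula
`φ(z⃗, x, y)` (the variables `x, y` are those indexed by `Fin 2`) such that, for all `A, B ∈ V`,
`A × B ⊨ φ([0⃗, 1⃗], (a, c), (b, d))` iff `c = d`. -/
def HasRexDFC {n : ℕ} (zero one : Fin n → L.Term Empty) : Prop :=
  ∃ φ : L.Formula (Fin n ⊕ Fin 2), FirstOrder.Language.BoundedFormula.IsExistential φ ∧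
    ∀ (A B : Type w) [L.Structure A] [L.Structure B], V.Mem A → V.Mem B →
      ∀ (a b : A) (c d : B),
        φ.Realize (Sum.elim (fun i => (const A (zero i), const B (one i)))
          ![(a, c), (b, d)] : Fin n ⊕ Fin 2 → A × B) ↔ c = d

end Variety

section Central

variable {L : FirstOrder.Language.{u, v}} {n : ℕ} (zero one : Fin n → L.Term Empty)

/-- `e⃗` is a central element of `A`: some isomorphism `τ : A → A₁ × A₂` maps `e⃗` to `[0⃗, 1⃗]`.
(If `A` belongs to a variety then so do `A₁` and `A₂`, being homomorphic images of `A`.) -/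
def IsCentral {A : Type w} [L.Structure A] (e : Fin n → A) : Prop :=
  ∃ (A₁ A₂ : Type w) (_ : L.Structure A₁) (_ : L.Structure A₂) (τ : A ≃[L] (A₁ × A₂)),
    ∀ i, τ (e i) = (const A₁ (zero i), const A₂ (one i))

/-- `(θ₀, θ₁)` is a pair of complementary factor congruences with `[e⃗, 0⃗] ∈ θ₀`
and `[e⃗, 1⃗] ∈ θ₁`. -/
structure IsFactorPair {A : Type w} [L.Structure A] (e : Fin n → A)
    (p : Congruence L A × Congruence L A) : Prop where
  complementary : Congruence.Complementary p.1 p.2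
  rel_zero : ∀ i, p.1.Rel (e i) (const A (zero i))
  rel_one : ∀ i, p.2.Rel (e i) (const A (one i))

variable {zero one}

theorem realize_prod {A B α : Type*} [L.Structure A] [L.Structure B] (t : L.Term α)
    (x : α → A × B) :
    t.realize x = (t.realize fun i => (x i).1, t.realize fun i => (x i).2) := by
  induction t with
  | var _ => rfl
  | func f ts ih =>
    simp only [Term.realize, ih]
    rfl

theorem const_prod {A B : Type*} [L.Structure A] [L.Structure B] (t : L.Term Empty) :
    const (A × B) t = (const A t, const B t) := by
  unfold const
  rw [realize_prod]
  congr 1 <;> congr 1 <;> exact Subsingleton.elim _ _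

theorem exists_isFactorPair {A : Type w} [L.Structure A] {e : Fin n → A}
    (he : IsCentral zero one e) : ∃ p, IsFactorPair zero one e p := by
  obtain ⟨A₁, A₂, _, _, τ, hτ⟩ := he
  have hc : ∀ t : L.Term Empty, τ (const A t) = (const A₁ t, const A₂ t) := by
    intro t
    rw [← const_prod]
    unfold const
    rw [← HomClass.realize_term]
    congr 1
    exact Subsingleton.elim _ _
  refine ⟨({ r := fun a b => (τ a).1 = (τ b).1
             iseqv := ⟨fun _ => rfl, fun h => h.symm, fun h h' => h.trans h'⟩
             compat := ?_ },
           { r := fun a b => (τ a).2 = (τ b).2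
             iseqv := ⟨fun _ => rfl, fun h => h.symm, fun h h' => h.trans h'⟩
             compat := ?_ }), ⟨?_, ?_⟩, ?_, ?_⟩
  · intro k f x y h
    rw [HomClass.map_fun, HomClass.map_fun]
    exact congrArg (funMap f) (funext h)
  · intro k f x y h
    rw [HomClass.map_fun, HomClass.map_fun]
    exact congrArg (funMap f) (funext h)
  · refine le_antisymm (fun a b h => ?_) bot_le
    exact τ.injective (Prod.ext h.1 h.2)
  · intro a b
    refine ⟨τ.symm ((τ a).1, (τ b).2), ?_, ?_⟩
    · change (τ a).1 = (τ (τ.symm _)).1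
      rw [τ.apply_symm_apply]
    · change (τ (τ.symm _)).2 = (τ b).2
      rw [τ.apply_symm_apply]
  · intro i
    change (τ _).1 = (τ _).1
    rw [hτ, hc]
  · intro i
    change (τ _).2 = (τ _).2
    rw [hτ, hc]

/-- A congruence of an algebra of `V` that identifies `0⃗` with `1⃗` is universal. -/
theorem eq_top_of_rel [L.IsAlgebraic] {V : Variety L} (h01 : V.HasZeroOne.{u, v, w} zero one)
    {A : Type w} [inst : L.Structure A] (hA : V.Mem A) (θ : Congruence L A)
    (h : ∀ i, θ.Rel (const A (zero i)) (const A (one i))) : θ = ⊤ := by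
  let ps : L.Prestructure θ.toSetoid :=
    { toStructure := inst
      fun_equiv := fun x y hxy => θ.compat _ x y hxy
      rel_equiv := fun {_} {r} => isEmptyElim r }
  have hmem : V.Mem (Quotient θ.toSetoid) := by
    refine ⟨hA.nonempty.map (Quotient.mk _), fun p hp x => ?_⟩
    have hx : x = fun i => (⟦(x i).out⟧ : Quotient θ.toSetoid) :=
      funext fun i => (Quotient.out_eq _).symm
    rw [hx, Term.realize_quotient_mk', Term.realize_quotient_mk']
    exact congrArg _ (hA.realize_eq p hp _)
  have hc : ∀ t : L.Term Empty, const (Quotient θ.toSetoid) t = ⟦const A t⟧ := by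
    intro t
    unfold const
    rw [← Term.realize_quotient_mk']
    congr 1
    exact Subsingleton.elim _ _
  have key := h01 (Quotient θ.toSetoid) hmem fun i => by
    rw [hc, hc]
    exact Quotient.sound (h i)
  refine le_antisymm le_top fun a b _ => ?_
  exact Quotient.exact (key ⟦a⟧ ⟦b⟧)

theorem IsFactorPair.swap {A : Type w} [L.Structure A] {e : Fin n → A}
    {p : Congruence L A × Congruence L A} (h : IsFactorPair zero one e p) :
    IsFactorPair one zero e p.swap := by
  refine ⟨⟨by rw [← h.1.1]; exact inf_comm _ _, fun a b => ?_⟩, h.3, h.2⟩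
  obtain ⟨c, h1, h2⟩ := h.1.2 b a
  exact ⟨c, p.2.rel_symm h2, p.1.rel_symm h1⟩

theorem IsFactorPair.fst_le [L.IsAlgebraic] {V : Variety L}
    (h01 : V.HasZeroOne.{u, v, w} zero one) (hBFC : V.HasBFC.{u, v, w})
    {A : Type w} [L.Structure A] (hA : V.Mem A) {e : Fin n → A}
    {p q : Congruence L A × Congruence L A} (hp : IsFactorPair zero one e p)
    (hq : IsFactorPair zero one e q) : q.1 ≤ p.1 := by
  have hB := hBFC A hA
  have htop : p.1 ⊔ q.2 = ⊤ := by
    refine eq_top_of_rel h01 hA _ fun i => ?_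
    have h1 : p.1 ≤ p.1 ⊔ q.2 := le_sup_left
    have h2 : q.2 ≤ p.1 ⊔ q.2 := le_sup_right
    exact Congruence.rel_trans _ (Congruence.rel_symm _ (h1 _ _ (hp.rel_zero i)))
      (h2 _ _ (hq.rel_one i))
  have hd := hB.inf_sup_distrib q.1 ⟨_, hq.1⟩ p.1 ⟨_, hp.1⟩ q.2 ⟨_, hq.swap.1⟩
  rw [htop, inf_top_eq, hq.1.1, sup_bot_eq] at hd
  exact inf_eq_left.mp hd.symm

/-- In a variety with `0⃗`, `1⃗` and BFC, a central element determines its pair of complementary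
factor congruences. -/
theorem existsUnique_isFactorPair [L.IsAlgebraic] {V : Variety L}
    (h01 : V.HasZeroOne.{u, v, w} zero one) (hBFC : V.HasBFC.{u, v, w})
    {A : Type w} [L.Structure A] (hA : V.Mem A) {e : Fin n → A} (he : IsCentral zero one e) :
    ∃! p, IsFactorPair zero one e p := by
  have h10 : V.HasZeroOne.{u, v, w} one zero := fun B _ hB h => h01 B hB fun i => (h i).symm
  obtain ⟨p, hp⟩ := exists_isFactorPair he
  refine ⟨p, hp, fun q hq => Prod.ext ?_ ?_⟩
  · exact le_antisymm (hp.fst_le h01 hBFC hA hq) (hq.fst_le h01 hBFC hA hp)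
  · exact le_antisymm (hp.swap.fst_le h10 hBFC hA hq.swap) (hq.swap.fst_le h10 hBFC hA hp.swap)

/-- `θ_{1⃗,e⃗}`: the second component of the unique pair of complementary factor congruences
`(θ_{0⃗,e⃗}, θ_{1⃗,e⃗})` with `[e⃗, 0⃗] ∈ θ_{0⃗,e⃗}` and `[e⃗, 1⃗] ∈ θ_{1⃗,e⃗}`. -/
noncomputable def thetaOne [L.IsAlgebraic] {V : Variety L}
    (h01 : V.HasZeroOne.{u, v, w} zero one) (hBFC : V.HasBFC.{u, v, w})
    {A : Type w} [L.Structure A] (hA : V.Mem A) {e : Fin n → A}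
    (he : IsCentral zero one e) : Congruence L A :=
  (existsUnique_isFactorPair h01 hBFC hA he).choose.2

end Central

end CentralElements

/-! Both implications of part 1 are about the second member `δ` of a factor pair `(θ, δ)` of `e` and
`γ = θ(1, e) ≤ δ`. From RexDFC to principality (`IsFactorPair.snd_eq_principal`): if `a δ b`, the
formula holds at `(e, a, b)` in `A ≅ A/θ × A/δ`. Since `θ ∩ γ ≤ θ ∩ δ` is equality, `A` also embeds
in `A/θ × A/γ`, with `e` going to `[0, 1]`. Existential formulas persist under embeddings, so `a γ
b`. From principality to RexDFC (`hasRexDFC_of_principal`): let `F` be free on `x, y`. In `F × F`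
the pair `(x, x), (y, x)` has equal second coordinates, so it lies in `θ(1, [0, 1])`. Finitely many
values of operations force this membership (`principal_le_finiteWitness`), and the existence of a
map respecting those values is an existential condition (`exists_diagram_formula`); that condition
is the formula. For part 2, a central `e` is recovered from its two congruences, and the second
determines the first because complements are unique under BFC. -/

namespace CentralElements

open FirstOrder FirstOrder.Language FirstOrder.Language.Structure

/-! ### Homomorphisms and closure properties of varieties -/

section Hom

variable {L : FirstOrder.Language.{u, v}}

/-- A map commuting with all operations, as a homomorphism of algebras. -/
def algHom [L.IsAlgebraic] {A B : Type*} [L.Structure A] [L.Structure B] (h : A → B)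
    (hf : ∀ {k : ℕ} (f : L.Functions k) (x : Fin k → A), h (funMap f x) = funMap f (h ∘ x)) :
    A →[L] B where
  toFun := h
  map_fun' := hf
  map_rel' := fun r => isEmptyElim r

theorem map_const {A B : Type*} [L.Structure A] [L.Structure B] (h : A →[L] B)
    (t : L.Term Empty) : h (const A t) = const B t := by
  unfold const
  rw [← HomClass.realize_term]
  congr 1
  exact Subsingleton.elim _ _

/-- Varieties are closed under homomorphic images. -/
theorem Variety.Mem.of_surjective {V : Variety L} {A B : Type*} [L.Structure A] [L.Structure B]
    (hA : V.Mem A) (h : A →[L] B) (hs : Function.Surjective h) : V.Mem B := by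
  refine ⟨hA.nonempty.map h, fun p hp x => ?_⟩
  obtain ⟨y, rfl⟩ : ∃ y : ℕ → A, h ∘ y = x :=
    ⟨fun i => (hs (x i)).choose, funext fun i => (hs (x i)).choose_spec⟩
  rw [HomClass.realize_term, HomClass.realize_term, hA.realize_eq p hp]

/-- Varieties are closed under binary products. -/
theorem Variety.Mem.prod {V : Variety L} {A B : Type*} [L.Structure A] [L.Structure B]
    (hA : V.Mem A) (hB : V.Mem B) : V.Mem (A × B) := by
  have := hA.nonempty
  have := hB.nonempty
  refine ⟨inferInstance, fun p hp x => ?_⟩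
  rw [realize_prod, realize_prod, hA.realize_eq p hp, hB.realize_eq p hp]

end Hom

/-! ### Quotients, kernels and direct decompositions -/

namespace Congruence

variable {L : FirstOrder.Language.{u, v}} {A : Type w} [L.Structure A]

/-- The quotient algebra `A/θ`. -/
def Quot (θ : Congruence L A) : Type w := Quotient θ.toSetoid

noncomputable instance (θ : Congruence L A) : L.Structure θ.Quot where
  funMap f x := Quotient.mk θ.toSetoid (funMap f fun i => Quotient.out (x i))
  RelMap _ _ := False

/-- The quotient homomorphism `A → A/θ`. -/
noncomputable def proj [L.IsAlgebraic] (θ : Congruence L A) : A →[L] θ.Quot :=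
  algHom (Quotient.mk θ.toSetoid) fun f x => Quotient.sound (s := θ.toSetoid)
    (θ.compat f _ _ fun i => θ.rel_symm (Quotient.mk_out (s := θ.toSetoid) (x i)))

theorem proj_surjective [L.IsAlgebraic] (θ : Congruence L A) : Function.Surjective θ.proj :=
  Quotient.exists_rep

theorem proj_eq_proj [L.IsAlgebraic] {θ : Congruence L A} {a b : A} :
    θ.proj a = θ.proj b ↔ θ.Rel a b :=
  Quotient.eq (r := θ.toSetoid)

/-- The kernel of a homomorphism. -/
def ker {B : Type*} [L.Structure B] (h : A →[L] B) : Congruence L A where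
  r a b := h a = h b
  iseqv := ⟨fun _ => rfl, fun h => h.symm, fun h h' => h.trans h'⟩
  compat f x y hxy := by
    rw [HomClass.map_fun, HomClass.map_fun]
    exact congrArg (funMap f) (funext hxy)

theorem principal_rel {n : ℕ} (a b : Fin n → A) (i : Fin n) :
    (principal (L := L) a b).Rel (a i) (b i) := fun _ hθ => hθ i

theorem principal_le {n : ℕ} {a b : Fin n → A} {θ : Congruence L A}
    (h : ∀ i, θ.Rel (a i) (b i)) : principal a b ≤ θ := fun _ _ hab => hab θ h

theorem Complementary.symm {θ δ : Congruence L A} (h : Complementary θ δ) :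
    Complementary δ θ := by
  refine ⟨by rw [inf_comm, h.1], fun a b => ?_⟩
  obtain ⟨c, h1, h2⟩ := h.2 b a
  exact ⟨c, δ.rel_symm h2, θ.rel_symm h1⟩

theorem Complementary.eq_of_rel {θ δ : Congruence L A} (h : Complementary θ δ) {a b : A}
    (h1 : θ.Rel a b) (h2 : δ.Rel a b) : a = b := by
  have : (θ ⊓ δ).Rel a b := ⟨h1, h2⟩
  rw [h.1] at this
  exact this

theorem Complementary.sup_eq_top {θ δ : Congruence L A} (h : Complementary θ δ) :
    θ ⊔ δ = ⊤ := by
  refine le_antisymm le_top fun a b _ => ?_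
  obtain ⟨c, h1, h2⟩ := h.2 a b
  exact rel_trans _ ((le_sup_left : θ ≤ θ ⊔ δ) _ _ h1) ((le_sup_right : δ ≤ θ ⊔ δ) _ _ h2)

/-- A pair of complementary factor congruences decomposes the algebra as a direct product. -/
noncomputable def Complementary.equiv [L.IsAlgebraic] {θ δ : Congruence L A}
    (h : Complementary θ δ) : A ≃[L] (θ.Quot × δ.Quot) where
  toEquiv := Equiv.ofBijective (fun a => (θ.proj a, δ.proj a)) <| by
    refine ⟨fun a b hab => ?_, fun ⟨x, y⟩ => ?_⟩
    · exact h.eq_of_rel (proj_eq_proj.1 (Prod.ext_iff.1 hab).1)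
        (proj_eq_proj.1 (Prod.ext_iff.1 hab).2)
    · obtain ⟨a, rfl⟩ := θ.proj_surjective x
      obtain ⟨b, rfl⟩ := δ.proj_surjective y
      obtain ⟨c, h1, h2⟩ := h.2 a b
      exact ⟨c, Prod.ext (proj_eq_proj.2 (θ.rel_symm h1)) (proj_eq_proj.2 h2)⟩
  map_fun' f x := Prod.ext (HomClass.map_fun θ.proj f x) (HomClass.map_fun δ.proj f x)
  map_rel' r := isEmptyElim r

theorem Complementary.equiv_apply [L.IsAlgebraic] {θ δ : Congruence L A}
    (h : Complementary θ δ) (a : A) : h.equiv a = (θ.proj a, δ.proj a) := rfl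

end Congruence

/-! ### Relatively free algebras -/

section FreeAlgebra

variable {L : FirstOrder.Language.{u, v}}

/-- The algebra of terms. -/
instance termStructure (α : Type*) : L.Structure (L.Term α) where
  funMap f ts := Term.func f ts
  RelMap _ _ := False

theorem realize_term_eq_subst {α β : Type*} (t : L.Term β) (y : β → L.Term α) :
    t.realize y = t.subst y := by
  induction t with
  | var _ => rfl
  | func f ts ih => exact congrArg (Term.func f) (funext ih)

/-- Two terms are congruent when they take the same values in all algebras of the variety. -/
def Variety.termCongr (V : Variety L) (α : Type*) : Congruence L (L.Term α) where
  r s t := ∀ (A : Type (max u w)) [L.Structure A], V.Mem A →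
    ∀ x : α → A, s.realize x = t.realize x
  iseqv := ⟨fun _ _ _ _ _ => rfl, fun h A _ hA x => (h A hA x).symm,
    fun h h' A _ hA x => (h A hA x).trans (h' A hA x)⟩
  compat f _ _ h A _ hA x := congrArg (funMap f) (funext fun i => h i A hA x)

/-- The relatively free algebra of the variety over the set `α`. -/
abbrev Variety.Free (V : Variety L) (α : Type (max u w)) : Type (max u w) :=
  (Variety.termCongr.{u, v, w} V α).Quot

theorem Variety.mem_free [L.IsAlgebraic] (V : Variety L) (α : Type (max u w)) [Nonempty α] :
    V.Mem (Variety.Free.{u, v, w} V α) := by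
  refine ⟨⟨Congruence.proj _ (Term.var (Classical.arbitrary α))⟩, fun p hp x => ?_⟩
  obtain ⟨y, rfl⟩ : ∃ y, Congruence.proj (Variety.termCongr.{u, v, w} V α) ∘ y = x :=
    ⟨fun i => (Congruence.proj_surjective _ (x i)).choose,
      funext fun i => (Congruence.proj_surjective _ (x i)).choose_spec⟩
  -- At classes of terms, both sides of an identity become classes of substitution instances, and
  -- these agree in every algebra of the variety.
  rw [HomClass.realize_term, HomClass.realize_term, Congruence.proj_eq_proj,
    realize_term_eq_subst, realize_term_eq_subst]
  intro A _ hA z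
  rw [Term.realize_subst, Term.realize_subst]
  exact hA.realize_eq p hp _

/-- The universal property of the relatively free algebra. -/
theorem Variety.exists_free_hom [L.IsAlgebraic] (V : Variety L) {α : Type (max u w)}
    {A : Type (max u w)} [L.Structure A] (hA : V.Mem A) (x : α → A) :
    ∃ h : Variety.Free.{u, v, w} V α →[L] A,
      ∀ i, h (Congruence.proj _ (Term.var i)) = x i := by
  let g : Variety.Free.{u, v, w} V α → A :=
    Quotient.lift (s := (Variety.termCongr.{u, v, w} V α).toSetoid)
      (fun t : L.Term α => t.realize x) fun _ _ hst => hst A hA x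
  have hg : ∀ t, g (Congruence.proj _ t) = t.realize x := fun _ => rfl
  refine ⟨algHom g fun f y => ?_, fun i => hg _⟩
  obtain ⟨z, rfl⟩ : ∃ z, Congruence.proj (Variety.termCongr.{u, v, w} V α) ∘ z = y :=
    ⟨fun i => (Congruence.proj_surjective _ (y i)).choose,
      funext fun i => (Congruence.proj_surjective _ (y i)).choose_spec⟩
  rw [← HomClass.map_fun, hg]
  rfl

end FreeAlgebra

/-! ### Generated congruences depend on finitely many values -/

section FiniteWitness

variable {L : FirstOrder.Language.{u, v}} {C : Type w} [L.Structure C]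

/-- `h` commutes with the applications of operations listed in `D`. -/
def PreservesOn (D : Set (Σ k, L.Functions k × (Fin k → C))) {X : Type*} [L.Structure X]
    (h : C → X) : Prop :=
  ∀ d ∈ D, h (funMap d.2.1 d.2.2) = funMap d.2.1 (h ∘ d.2.2)

theorem PreservesOn.mono {D E : Set (Σ k, L.Functions k × (Fin k → C))} {X : Type*}
    [L.Structure X] {h : C → X} (hE : PreservesOn E h) (hDE : D ⊆ E) : PreservesOn D h :=
  fun d hd => hE d (hDE hd)

/-- A closed term has finitely many subterms, so it suffices to list one application of an operation
for each of them. -/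
theorem exists_finite_preserves_const (C : Type w) [L.Structure C] (t : L.Term Empty) :
    ∃ D : Set (Σ k, L.Functions k × (Fin k → C)), D.Finite ∧
      ∀ (X : Type w) [L.Structure X] (h : C → X), PreservesOn D h →
        h (const C t) = const X t := by
  induction t with
  | var i => exact i.elim
  | func f ts ih =>
    choose D hD h using ih
    refine ⟨insert ⟨_, f, fun i => const C (ts i)⟩ (⋃ i, D i),
      (Set.finite_iUnion hD).insert _, fun X _ g hg => ?_⟩
    refine (hg _ (Set.mem_insert _ _)).trans (congrArg (funMap f) (funext fun i => ?_))
    exact h i X g (hg.mono ((Set.subset_iUnion D i).trans (Set.subset_insert _ _)))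

/-- Pairs of elements whose membership in the congruence generated by `(1⃗, e⃗)` is forced by
finitely many values of the operations. -/
def finiteWitness {n : ℕ} (one : Fin n → L.Term Empty) (e : Fin n → C) : Congruence L C where
  r p q := ∃ D : Set (Σ k, L.Functions k × (Fin k → C)), D.Finite ∧
    ∀ (X : Type w) [L.Structure X] (h : C → X), PreservesOn D h →
      (Congruence.principal (L := L) (fun i => const X (one i)) (h ∘ e)).Rel (h p) (h q)
  iseqv := by
    refine ⟨fun a => ⟨∅, Set.finite_empty, fun X _ h _ => Congruence.rel_refl _ _⟩, ?_, ?_⟩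
    · rintro a b ⟨D, hD, H⟩
      exact ⟨D, hD, fun X _ h hh => Congruence.rel_symm _ (H X h hh)⟩
    · rintro a b c ⟨D, hD, H⟩ ⟨D', hD', H'⟩
      exact ⟨D ∪ D', hD.union hD', fun X _ h hh => Congruence.rel_trans _
        (H X h (hh.mono Set.subset_union_left)) (H' X h (hh.mono Set.subset_union_right))⟩
  compat f x y hxy := by
    choose D hD H using hxy
    -- Besides the data for the arguments, `h` must respect the two applications `f x` and `f y`;
    -- finiteness survives because `f` is finitary.
    refine ⟨insert ⟨_, f, x⟩ (insert ⟨_, f, y⟩ (⋃ i, D i)),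
      ((Set.finite_iUnion hD).insert _).insert _, fun X _ h hh => ?_⟩
    have hx : h (funMap f x) = funMap f (h ∘ x) := hh _ (Set.mem_insert _ _)
    have hy : h (funMap f y) = funMap f (h ∘ y) :=
      hh _ (Set.mem_insert_of_mem _ (Set.mem_insert _ _))
    rw [hx, hy]
    refine Congruence.compat _ f _ _ fun i => H i X h (hh.mono ?_)
    exact (Set.subset_iUnion D i).trans
      ((Set.subset_insert _ _).trans (Set.subset_insert _ _))

/-- This plays the role of Mal'cev chains: the finitely witnessed pairs already form a congruence,
so only the generating pairs need a witness, and there it is enough that `h` fixes the value of `one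
i`. -/
theorem principal_le_finiteWitness {n : ℕ} (one : Fin n → L.Term Empty) (e : Fin n → C) :
    Congruence.principal (fun i => const C (one i)) e ≤ finiteWitness one e := by
  refine Congruence.principal_le fun i => ?_
  obtain ⟨D, hD, H⟩ := exists_finite_preserves_const C (one i)
  refine ⟨D, hD, fun X _ h hh => ?_⟩
  rw [H X h hh]
  exact Congruence.principal_rel (fun i => const X (one i)) (h ∘ e) i

end FiniteWitness

/-! ### Existential formulas from finite diagrams -/

section Existential

variable {L : FirstOrder.Language.{u, v}}

theorem isQF_iInf {α β : Type*} [Finite β] {m : ℕ} (f : β → L.BoundedFormula α m)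
    (hf : ∀ b, (f b).IsQF) : (BoundedFormula.iInf f).IsQF := by
  change BoundedFormula.IsQF (List.foldr (· ⊓ ·) ⊤
    (List.map f (@Finset.univ β (Fintype.ofFinite β)).toList))
  generalize (@Finset.univ β (Fintype.ofFinite β)).toList = l
  induction l with
  | nil => exact BoundedFormula.IsQF.top
  | cons b l ih => exact (hf b).inf ih

theorem isExistential_exs {α : Type*} {m : ℕ} {φ : L.BoundedFormula α m}
    (h : φ.IsExistential) : BoundedFormula.IsExistential φ.exs := by
  induction m with
  | zero => exact h
  | succ m ih => exact ih h.ex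

/-- The solvability of a finite system of equations is expressed by an existential formula. -/
theorem exists_isExistential_realize_iff {α β : Type*} [Finite β] {m : ℕ}
    (s t : β → L.Term (α ⊕ Fin m)) :
    ∃ φ : L.Formula α, BoundedFormula.IsExistential φ ∧
      ∀ (M : Type w) [L.Structure M] (z : α → M), φ.Realize z ↔
        ∃ y : Fin m → M, ∀ b,
          (s b).realize (Sum.elim z y) = (t b).realize (Sum.elim z y) := by
  refine ⟨(BoundedFormula.iInf fun b => (s b).bdEqual (t b)).exs, ?_, fun M _ z => ?_⟩
  · exact isExistential_exs
      (isQF_iInf _ fun b => (BoundedFormula.IsAtomic.equal _ _).isQF).isExistential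
  · rw [BoundedFormula.realize_exs]
    simp only [BoundedFormula.realize_iInf, BoundedFormula.realize_bdEqual]

/-- An existential formula expressing that a finite part of `C` maps to an algebra, with prescribed
values at the elements `c`. -/
theorem exists_diagram_formula {C : Type w} [L.Structure C] {α : Type} [Finite α] (c : α → C)
    {D : Set (Σ k, L.Functions k × (Fin k → C))} (hD : D.Finite) :
    ∃ φ : L.Formula α, BoundedFormula.IsExistential φ ∧
      ∀ (X : Type w) [L.Structure X] (z : α → X),
        (φ.Realize z → ∃ h : C → X, PreservesOn D h ∧ h ∘ c = z) ∧
        ∀ h : C →[L] X, h ∘ c = z → φ.Realize z := by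
  classical
  -- A point of `C` is needed below as the default value of `g'`.
  rcases isEmpty_or_nonempty C with hC | hC
  · have : IsEmpty α := ⟨fun i => hC.elim (c i)⟩
    refine ⟨⊤, BoundedFormula.IsQF.top.isExistential, fun X _ z => ⟨fun _ => ?_, fun _ _ => ?_⟩⟩
    · refine ⟨fun x => hC.elim x, fun d _ => ?_, funext fun i => isEmptyElim i⟩
      exact hC.elim (funMap d.2.1 d.2.2)
    · exact Formula.realize_top.2 trivial
  have := hD.to_subtype
  let S : Set C := Set.range c ∪
    ⋃ d : D, insert (funMap d.1.2.1 d.1.2.2) (Set.range d.1.2.2)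
  have hS : S.Finite := (Set.finite_range c).union
    (Set.finite_iUnion fun d => (Set.finite_range _).insert _)
  have hcS : ∀ i, c i ∈ S := fun i => Or.inl ⟨i, rfl⟩
  have hfS : ∀ d ∈ D, funMap d.2.1 d.2.2 ∈ S := fun d hd =>
    Or.inr (Set.mem_iUnion.2 ⟨⟨d, hd⟩, Set.mem_insert _ _⟩)
  have hxS : ∀ d ∈ D, ∀ i, d.2.2 i ∈ S := fun d hd i =>
    Or.inr (Set.mem_iUnion.2 ⟨⟨d, hd⟩, Set.mem_insert_of_mem _ ⟨i, rfl⟩⟩)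
  have := hS.to_subtype
  -- One bound variable for each relevant element of `C`; the extra `none` receives all other
  -- elements, which makes `g` total.
  obtain ⟨m, ⟨ε⟩⟩ := Finite.exists_equiv_fin (Option S)
  let g : C → Fin m := fun x => ε (if hx : x ∈ S then some ⟨x, hx⟩ else none)
  let g' : Fin m → C := fun j => (ε.symm j).elim hC.some Subtype.val
  have hg : ∀ x ∈ S, g' (g x) = x := fun x hx => by simp [g, g', hx]
  -- The equations tie each free variable to the bound variable of `c i`, and record each
  -- application listed in `D`.
  let s : α ⊕ D → L.Term (α ⊕ Fin m) := Sum.elim (fun i => Term.var (Sum.inl i))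
    fun d => Term.var (Sum.inr (g (funMap d.1.2.1 d.1.2.2)))
  let t : α ⊕ D → L.Term (α ⊕ Fin m) := Sum.elim (fun i => Term.var (Sum.inr (g (c i))))
    fun d => Term.func d.1.2.1 fun i => Term.var (Sum.inr (g (d.1.2.2 i)))
  obtain ⟨φ, hφ, H⟩ := exists_isExistential_realize_iff.{u, v, w} s t
  refine ⟨φ, hφ, fun X _ z => ⟨fun hz => ?_, fun h hz => (H X z).2 ⟨h ∘ g', ?_⟩⟩⟩
  · obtain ⟨y, hy⟩ := (H X z).1 hz
    exact ⟨y ∘ g, fun d hd => hy (Sum.inr ⟨d, hd⟩), funext fun i => (hy (Sum.inl i)).symm⟩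
  · subst hz
    rintro (i | d)
    · change h (c i) = h (g' (g (c i)))
      rw [hg _ (hcS i)]
    · change h (g' (g (funMap d.1.2.1 d.1.2.2))) =
        funMap d.1.2.1 fun i => h (g' (g (d.1.2.2 i)))
      rw [hg _ (hfS _ d.2), HomClass.map_fun]
      exact congrArg _ (funext fun i => by rw [hg _ (hxS _ d.2 i)]; rfl)

end Existential

/-! ### Principality and definability -/

section Main

variable {L : FirstOrder.Language.{u, v}} [L.IsAlgebraic] {V : Variety L} {n : ℕ}
  {zero one : Fin n → L.Term Empty}

theorem isFactorPair_thetaOne (h01 : V.HasZeroOne.{u, v, w} zero one)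
    (hBFC : V.HasBFC.{u, v, w}) {A : Type w} [L.Structure A] (hA : V.Mem A) {e : Fin n → A}
    (he : IsCentral zero one e) :
    ∃ δ, IsFactorPair zero one e (δ, thetaOne h01 hBFC hA he) :=
  ⟨(existsUnique_isFactorPair h01 hBFC hA he).choose.1,
    (existsUnique_isFactorPair h01 hBFC hA he).choose_spec.1⟩

theorem thetaOne_eq (h01 : V.HasZeroOne.{u, v, w} zero one)
    (hBFC : V.HasBFC.{u, v, w}) {A : Type w} [L.Structure A] (hA : V.Mem A) {e : Fin n → A}
    (he : IsCentral zero one e) {p : Congruence L A × Congruence L A}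
    (hp : IsFactorPair zero one e p) : thetaOne h01 hBFC hA he = p.2 := by
  obtain ⟨δ, hδ⟩ := isFactorPair_thetaOne h01 hBFC hA he
  obtain ⟨q, -, hq⟩ := existsUnique_isFactorPair h01 hBFC hA he
  exact (Prod.ext_iff.1 ((hq _ hδ).trans (hq _ hp).symm)).2

/-- A complementary pair of factor congruences with `[e⃗, 0⃗]` and `[e⃗, 1⃗]` in its members
shows that `e⃗` is central. -/
theorem IsFactorPair.isCentral {A : Type w} [L.Structure A] {e : Fin n → A}
    {p : Congruence L A × Congruence L A} (hp : IsFactorPair zero one e p) :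
    IsCentral zero one e := by
  refine ⟨p.1.Quot, p.2.Quot, inferInstance, inferInstance, hp.1.equiv, fun i => ?_⟩
  rw [hp.1.equiv_apply, ← map_const p.1.proj, ← map_const p.2.proj]
  exact Prod.ext (Congruence.proj_eq_proj.2 (hp.2 i)) (Congruence.proj_eq_proj.2 (hp.3 i))

/-- Makes the principality hypothesis usable in products: it turns `θ(1, [0, 1])` into equality of
second coordinates. -/
theorem isFactorPair_prod (A B : Type w) [L.Structure A] [L.Structure B] [Nonempty A]
    [Nonempty B] :
    IsFactorPair zero one (fun i => ((const A (zero i), const B (one i)) : A × B))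
      (Congruence.ker (L := L) (algHom Prod.fst fun _ _ => rfl : A × B →[L] A),
        Congruence.ker (L := L) (algHom Prod.snd fun _ _ => rfl : A × B →[L] B)) := by
  refine ⟨⟨le_antisymm (fun a b h => Prod.ext h.1 h.2) bot_le,
    fun a b => ⟨(a.1, b.2), rfl, rfl⟩⟩, fun i => ?_, fun i => ?_⟩
  · change const A (zero i) = (const (A × B) (zero i)).1
    rw [const_prod]
  · change const B (one i) = (const (A × B) (one i)).2
    rw [const_prod]

/-- Under RexDFC, the second congruence of a factor pair is principal. -/
theorem IsFactorPair.snd_eq_principal (h : V.HasRexDFC.{u, v, w} zero one)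
    {A : Type w} [L.Structure A] (hA : V.Mem A) {e : Fin n → A}
    {p : Congruence L A × Congruence L A} (hp : IsFactorPair zero one e p) :
    p.2 = Congruence.principal (fun i => const A (one i)) e := by
  obtain ⟨φ, hφ, H⟩ := h
  obtain ⟨θ, δ⟩ := p
  set γ : Congruence L A := Congruence.principal (fun i => const A (one i)) e
  have hγδ : γ ≤ δ := Congruence.principal_le fun i => δ.rel_symm (hp.3 i)
  have hQ : ∀ θ : Congruence L A, V.Mem θ.Quot := fun θ =>
    hA.of_surjective θ.proj θ.proj_surjective
  refine le_antisymm (fun a b hab => ?_) hγδ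
  have h1 : φ.Realize (Sum.elim e ![a, b]) := by
    have h2 := (H θ.Quot δ.Quot (hQ θ) (hQ δ) (θ.proj a) (θ.proj b) (δ.proj a) (δ.proj b)).2
      (Congruence.proj_eq_proj.2 hab)
    have h3 := hφ.realize_embedding hp.1.equiv.symm h2
    refine (congrArg₂ (BoundedFormula.Realize φ) (funext ?_) (Subsingleton.elim _ _)).mp h3
    rintro (i | i)
    · refine hp.1.equiv.injective ?_
      refine (hp.1.equiv.apply_symm_apply _).trans ?_
      exact (Prod.ext ((Congruence.proj_eq_proj.2 (hp.2 i)).trans (map_const _ _))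
        ((Congruence.proj_eq_proj.2 (hp.3 i)).trans (map_const _ _))).symm
    · fin_cases i
      · exact hp.1.equiv.symm_apply_apply a
      · exact hp.1.equiv.symm_apply_apply b
  -- `j` need not be onto; injectivity suffices to transfer an existential formula.
  let j : A →[L] θ.Quot × γ.Quot := algHom (fun x => (θ.proj x, γ.proj x)) fun f x =>
    Prod.ext (HomClass.map_fun θ.proj f x) (HomClass.map_fun γ.proj f x)
  have hj : Function.Injective j := fun x y hxy => hp.1.eq_of_rel
    (Congruence.proj_eq_proj.1 (Prod.ext_iff.1 hxy).1)
    (hγδ _ _ (Congruence.proj_eq_proj.1 (Prod.ext_iff.1 hxy).2))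
  have h4 := hφ.realize_embedding (Embedding.ofInjective hj) h1
  refine Congruence.proj_eq_proj.1
    ((H θ.Quot γ.Quot (hQ θ) (hQ γ) (θ.proj a) (θ.proj b) (γ.proj a) (γ.proj b)).1 ?_)
  refine (congrArg₂ (BoundedFormula.Realize φ) (funext ?_) (Subsingleton.elim _ _)).mp h4
  rintro (i | i)
  · refine Prod.ext ((Congruence.proj_eq_proj.2 (hp.2 i)).trans (map_const _ _))
      (Eq.trans (Congruence.proj_eq_proj.2 ?_) (map_const γ.proj _))
    exact γ.rel_symm (Congruence.principal_rel (fun i => const A (one i)) e i)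
  · fin_cases i <;> rfl

/-- If the second congruences of factor pairs are principal, then the variety has RexDFC. -/
theorem hasRexDFC_of_principal
    (H : ∀ (A : Type (max u w)) [L.Structure A], V.Mem A → ∀ (e : Fin n → A)
      (p : Congruence L A × Congruence L A), IsFactorPair zero one e p →
        p.2 = Congruence.principal (fun i => const A (one i)) e) :
    V.HasRexDFC.{u, v, max u w} zero one := by
  -- The two free generators, lifted to the universe of the algebras.
  let ι := ULift.{max u w} (Fin 2)
  let F := Variety.Free.{u, v, w} V ι
  have hF : V.Mem F := V.mem_free ι
  have := hF.nonempty
  let x : ι → F := fun i => Congruence.proj _ (Term.var i)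
  let e : Fin n → F × F := fun i => (const F (zero i), const F (one i))
  have hxy : (Congruence.principal (L := L) (fun i => const (F × F) (one i)) e).Rel
      (x ⟨0⟩, x ⟨0⟩) (x ⟨1⟩, x ⟨0⟩) := by
    rw [← H _ (hF.prod hF) _ _ (isFactorPair_prod F F)]
    rfl
  obtain ⟨D, hD, hDX⟩ := principal_le_finiteWitness one e _ _ hxy
  obtain ⟨φ, hφ, hφX⟩ := exists_diagram_formula
    (Sum.elim e ![(x ⟨0⟩, x ⟨0⟩), (x ⟨1⟩, x ⟨0⟩)]) hD
  refine ⟨φ, hφ, fun A B _ _ hA hB a b c d => ⟨fun h => ?_, ?_⟩⟩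
  · have := hA.nonempty
    have := hB.nonempty
    obtain ⟨h, hh, hz⟩ := (hφX (A × B) _).1 h
    have he : h ∘ e = fun i => (const A (zero i), const B (one i)) :=
      funext fun i => congrFun hz (Sum.inl i)
    have h0 := congrFun hz (Sum.inr 0)
    have h1 := congrFun hz (Sum.inr 1)
    have key := hDX (A × B) h hh
    -- The hypothesis is applied a second time, now in `A × B`: the forced membership there means
    -- equal second coordinates.
    rw [he, ← H _ (hA.prod hB) _ _ (isFactorPair_prod A B)] at key
    simp only [Function.comp_apply, Sum.elim_inr, Matrix.cons_val_zero,
      Matrix.cons_val_one] at h0 h1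
    change (h (x ⟨0⟩, x ⟨0⟩)).2 = (h (x ⟨1⟩, x ⟨0⟩)).2 at key
    rwa [h0, h1] at key
  · rintro rfl
    -- With `c = d`, the map `f × g` sends `(x, x)` to `(a, c)` and `(y, x)` to `(b, c)`; being a
    -- homomorphism, it satisfies every finite diagram.
    obtain ⟨f, hf⟩ := V.exists_free_hom hA (fun i : ι => ![a, b] i.down)
    obtain ⟨g, hg⟩ := V.exists_free_hom hB (fun _ : ι => c)
    refine (hφX (A × B) _).2 (algHom (fun y : F × F => (f y.1, g y.2)) fun k y =>
      Prod.ext (HomClass.map_fun f k _) (HomClass.map_fun g k _)) (funext ?_)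
    rintro (i | i)
    · exact Prod.ext (map_const f _) (map_const g _)
    · fin_cases i
      · exact Prod.ext (hf ⟨0⟩) (hg ⟨0⟩)
      · exact Prod.ext (hf ⟨1⟩) (hg ⟨0⟩)

omit [L.IsAlgebraic] in
/-- Under BFC a factor congruence has only one complementary factor congruence. -/
theorem complementary_unique (hBFC : V.HasBFC.{u, v, w}) {A : Type w} [L.Structure A]
    (hA : V.Mem A) {θ δ δ' : Congruence L A} (h : Congruence.Complementary δ θ)
    (h' : Congruence.Complementary δ' θ) : δ = δ' := by
  have key : ∀ {δ δ' : Congruence L A}, Congruence.Complementary δ θ →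
      Congruence.Complementary δ' θ → δ ≤ δ' := fun {δ δ'} h h' => by
    -- Distributivity gives `δ = δ ⊓ (δ' ⊔ θ) = (δ ⊓ δ') ⊔ (δ ⊓ θ) = δ ⊓ δ'`.
    have hd := (hBFC A hA).inf_sup_distrib δ ⟨_, h⟩ δ' ⟨_, h'⟩ θ ⟨_, h.symm⟩
    rw [h'.sup_eq_top, inf_top_eq, h.1, sup_bot_eq] at hd
    exact inf_eq_left.mp hd.symm
  exact le_antisymm (key h h') (key h' h)

end Main

end CentralElements

/-! ### The main theorem -/

theorem mainTheorem2 {L : FirstOrder.Language.{u, v}} [L.IsAlgebraic]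
    (V : CentralElements.Variety L) {n : ℕ} (zero one : Fin n → L.Term Empty)
    (h01 : V.HasZeroOne.{u, v, max u w} zero one) (hBFC : V.HasBFC.{u, v, max u w}) :
    (V.HasRexDFC.{u, v, max u w} zero one ↔
      ∀ (A : Type (max u w)) [L.Structure A] (hA : V.Mem A) (e : Fin n → A)
        (he : CentralElements.IsCentral zero one e),
        CentralElements.thetaOne h01 hBFC hA he =
          CentralElements.Congruence.principal
            (fun i => CentralElements.const A (one i)) e) ∧
    (V.HasRexDFC.{u, v, max u w} zero one →
      ∀ (A : Type (max u w)) [L.Structure A], V.Mem A →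
        Set.BijOn
          (fun e : Fin n → A => (CentralElements.Congruence.principal
            (fun i => CentralElements.const A (one i)) e : CentralElements.Congruence L A))
          {e | CentralElements.IsCentral zero one e}
          {θ | CentralElements.Congruence.IsFactor θ}) := by
  open CentralElements in
  refine ⟨⟨fun h A _ hA e he => ?_, fun h => ?_⟩, fun h A _ hA => ⟨?_, ?_, ?_⟩⟩
  · obtain ⟨δ, hδ⟩ := isFactorPair_thetaOne h01 hBFC hA he
    exact hδ.snd_eq_principal h hA
  · refine hasRexDFC_of_principal.{u, v, w} fun A _ hA e p hp => ?_
    rw [← h A hA e hp.isCentral, thetaOne_eq h01 hBFC hA _ hp]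
  · intro e he
    obtain ⟨p, hp⟩ := exists_isFactorPair he
    change Congruence.IsFactor (Congruence.principal (fun i => const A (one i)) e)
    rw [← hp.snd_eq_principal h hA]
    exact ⟨_, hp.1.symm⟩
  · intro e he f hf hef
    obtain ⟨p, hp⟩ := exists_isFactorPair he
    obtain ⟨q, hq⟩ := exists_isFactorPair hf
    have h2 : p.2 = q.2 := by
      rw [hp.snd_eq_principal h hA, hq.snd_eq_principal h hA]
      exact hef
    have h1 : p.1 = q.1 := complementary_unique hBFC hA hp.1 (h2 ▸ hq.1)
    obtain rfl : p = q := Prod.ext h1 h2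
    exact funext fun i => hp.1.eq_of_rel
      (p.1.rel_trans (hp.2 i) (p.1.rel_symm (hq.2 i)))
      (p.2.rel_trans (hp.3 i) (p.2.rel_symm (hq.3 i)))
  · rintro θ ⟨δ, hδ⟩
    -- The central element with second congruence `θ` interpolates: each `e i` is `δ`-related to `0`
    -- and `θ`-related to `1`.
    choose e he0 he1 using fun i => hδ.symm.2 (const A (zero i)) (const A (one i))
    have hp : IsFactorPair zero one e (δ, θ) :=
      ⟨hδ.symm, fun i => δ.rel_symm (he0 i), he1⟩
    exact ⟨e, hp.isCentral, (hp.snd_eq_principal h hA).symm⟩
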